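/- For every $n$ there is a constant $C>0$, depending only on $n$, with the following property. Let $\mu=\sum_{\lambda\in\Lambda}\mu(\lambda)\delta_\lambda$ ($\mu(\lambda)\neq0$) be a pure point complex measure on $\mathbb R^n$ which is slowly increasing, i.e. $|\mu|(\{|x|<R\})=O(R^N)$ as $R\to\infty$ for some $N$. Assume that: 1. $\mu$ is positive-definite, i.e. its Fourier transform $\widehat\mu$ as a tempered distribution ($\langle\widehat\mu,\varphi\rangle=\langle\mu,\widehat\varphi\rangle$, $\widehat\varphi(t)=\int\varphi(x)e^{-2\pi i\langle t,x\rangle}dx$) satisfies $\langle\widehat\mu,\varphi\rangle\ge0$ for every Schwartz function $\varphi\ge0$; 2. $\widehat\mu$ is also a slowly increasing pure point measure, $\widehat\mu=\sum_{s\in S}\widehat\mu(s)\delta_s$ with $\widehat\mu(s)\neq0$ (here $S$ is countable and need not be closed; it is called the spectrum of $\mu$); 3. $\Lambda$ (the support of $\mu$) is uniformly discrete, where a set $A\subset\mathbb R^n$ is called uniformly discrete if $d(A):=\inf_{a,a'\in A,\,a\ne a'}|a-a'|>0$ (with $\inf\emptyset=\infty$). Then either $S$ is also uniformly discrete, or $S$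 has a relatively dense set of accumulation points, i.e. there is $R>0$ such that every ball of radius $R$ in $\mathbb R^n$ contains an accumulation point of $S$. Moreover, if $S$ is not uniformly discrete, then every ball of radius $C/d(\Lambda)$ contains infinitely many points of $S$. -/

import Mathlib

open scoped FourierTransform SchwartzMap ENNReal NNReal ComplexOrder

/-- A slowly increasing pure point complex measure `∑ x, mass x • δ_x` on `ℝⁿ`, given by its atoms.
The total variation of the open ball `B_R` is the sum of the `‖mass x‖` over `x ∈ B_R`; it is
required to be finite and to grow at most polynomially as `R → ∞`. In particular, the measure
is locally finite and has at most countably many non-zero atoms. -/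
structure PurePointMeasure (n : ℕ) where
  /-- The mass of each one-point set. -/
  mass : EuclideanSpace ℝ (Fin n) → ℂ
  /-- The total variation of `B_R` is `O(R ^ N)` for some `N`. -/
  slowlyIncreasing : ∃ (N : ℕ) (C : ℝ≥0), ∀ R : ℝ, 1 ≤ R →
    ∑' x : Metric.ball (0 : EuclideanSpace ℝ (Fin n)) R, ‖mass x‖ₑ ≤ C * ENNReal.ofReal R ^ N

namespace PurePointMeasure

/-- The support of a pure point measure: the set of its non-zero atoms (not its closure). -/
def support {n : ℕ} (μ : PurePointMeasure n) : Set (EuclideanSpace ℝ (Fin n)) :=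
  {x | μ.mass x ≠ 0}

/-- A slowly increasing measure integrates some negative power of `1 + ‖x‖`. -/
theorem exists_summable {n : ℕ} (μ : PurePointMeasure n) : ∃ k : ℕ,
    Summable fun x => ‖μ.mass x‖ * ((1 + ‖x‖) ^ k)⁻¹ := by
  obtain ⟨N, C, h⟩ := μ.slowlyIncreasing
  refine ⟨N + 1, ?_⟩
  have key : ∀ x : EuclideanSpace ℝ (Fin n), ENNReal.ofReal (((1 + ‖x‖) ^ (N + 1))⁻¹) ≤
      ∑' j : ℕ, (Metric.ball (0 : EuclideanSpace ℝ (Fin n)) (2 ^ j)).indicator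
        (fun _ => (2 : ℝ≥0∞) ^ (N + 1) * (((2 : ℝ≥0∞) ^ j) ^ (N + 1))⁻¹) x := by
    intro x
    have hx : (1 : ℝ) ≤ 1 + ‖x‖ := by linarith [norm_nonneg x]
    obtain ⟨m, hm1, hm2⟩ := exists_nat_pow_near hx one_lt_two
    refine le_trans ?_ (ENNReal.le_tsum (m + 1))
    rw [Set.indicator_of_mem (by simp only [mem_ball_zero_iff]; linarith)]
    have h2 : (2 : ℝ≥0∞) ^ (N + 1) * (((2 : ℝ≥0∞) ^ (m + 1)) ^ (N + 1))⁻¹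
        = ENNReal.ofReal (((2 : ℝ) ^ m) ^ (N + 1))⁻¹ := by
      rw [ENNReal.ofReal_inv_of_pos (by positivity), ENNReal.ofReal_pow (by positivity),
        ENNReal.ofReal_pow (by positivity), ENNReal.ofReal_ofNat, pow_succ (2 : ℝ≥0∞) m, mul_pow,
        ENNReal.mul_inv (by simp) (by simp), mul_comm, mul_assoc,
        ENNReal.inv_mul_cancel (by simp) (by simp), mul_one]
    rw [h2]
    gcongr
  have hfin : ∑' x, ‖μ.mass x‖ₑ * ENNReal.ofReal (((1 + ‖x‖) ^ (N + 1))⁻¹) ≠ ∞ := by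
    refine ne_top_of_le_ne_top (b := ∑' j : ℕ, (2 : ℝ≥0∞) ^ (N + 1) * C * 2⁻¹ ^ j) ?_ ?_
    · rw [ENNReal.tsum_mul_left, ENNReal.tsum_geometric]
      refine ENNReal.mul_ne_top (ENNReal.mul_ne_top (by simp) (by simp)) ?_
      simp
    · calc _ ≤ ∑' x, ‖μ.mass x‖ₑ * ∑' j : ℕ,
            (Metric.ball (0 : EuclideanSpace ℝ (Fin n)) (2 ^ j)).indicator
              (fun _ => (2 : ℝ≥0∞) ^ (N + 1) * (((2 : ℝ≥0∞) ^ j) ^ (N + 1))⁻¹) x := by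
            gcongr with x
            exact key x
        _ = ∑' j : ℕ, ((2 : ℝ≥0∞) ^ (N + 1) * (((2 : ℝ≥0∞) ^ j) ^ (N + 1))⁻¹) *
            ∑' x : Metric.ball (0 : EuclideanSpace ℝ (Fin n)) (2 ^ j), ‖μ.mass x‖ₑ := by
            simp_rw [← ENNReal.tsum_mul_left]
            rw [ENNReal.tsum_comm]
            refine tsum_congr fun j => ?_
            rw [tsum_subtype (Metric.ball (0 : EuclideanSpace ℝ (Fin n)) (2 ^ j))
              (fun x => (2 : ℝ≥0∞) ^ (N + 1) * (((2 : ℝ≥0∞) ^ j) ^ (N + 1))⁻¹ * ‖μ.mass x‖ₑ)]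
            refine tsum_congr fun x => ?_
            by_cases hx : x ∈ Metric.ball (0 : EuclideanSpace ℝ (Fin n)) (2 ^ j)
            · rw [Set.indicator_of_mem hx, Set.indicator_of_mem hx, mul_comm]
            · rw [Set.indicator_of_notMem hx, Set.indicator_of_notMem hx, mul_zero]
        _ ≤ _ := by
            refine ENNReal.tsum_le_tsum fun j => ?_
            have hj := h (2 ^ j) (one_le_pow₀ one_le_two)
            rw [ENNReal.ofReal_pow (by positivity), ENNReal.ofReal_ofNat] at hj
            refine (mul_le_mul_right hj _).trans (le_of_eq ?_)
            have h3 : (((2 : ℝ≥0∞) ^ j) ^ (N + 1))⁻¹ * ((2 : ℝ≥0∞) ^ j) ^ N = 2⁻¹ ^ j := by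
              rw [pow_succ, ENNReal.mul_inv (by simp) (by simp), mul_right_comm,
                ENNReal.inv_mul_cancel (by simp) (by simp), one_mul, ENNReal.inv_pow]
            rw [← h3]
            ring
  refine (ENNReal.summable_toReal hfin).congr fun x => ?_
  rw [ENNReal.toReal_mul, toReal_enorm, ENNReal.toReal_ofReal (by positivity)]

/-- The integral of a Schwartz function against a slowly increasing measure is bounded by one
Schwartz seminorm, and the series defining it converges absolutely. -/
theorem exists_bound {n : ℕ} (μ : PurePointMeasure n) : ∃ (k : ℕ) (C : ℝ), 0 ≤ C ∧
    ∀ φ : 𝓢(EuclideanSpace ℝ (Fin n), ℂ), (Summable fun x => ‖μ.mass x * φ x‖) ∧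
      ‖∑' x, μ.mass x * φ x‖ ≤ C * (Finset.Iic (k, 0)).sup
        (schwartzSeminormFamily ℂ (EuclideanSpace ℝ (Fin n)) ℂ) φ := by
  obtain ⟨k, hk⟩ := μ.exists_summable
  refine ⟨k, 2 ^ k * ∑' x, ‖μ.mass x‖ * ((1 + ‖x‖) ^ k)⁻¹, by positivity, fun φ => ?_⟩
  set s := (Finset.Iic (k, 0)).sup (schwartzSeminormFamily ℂ (EuclideanSpace ℝ (Fin n)) ℂ) φ
    with hs
  have hb : ∀ x, ‖μ.mass x * φ x‖ ≤ ‖μ.mass x‖ * ((1 + ‖x‖) ^ k)⁻¹ * (2 ^ k * s) := by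
    intro x
    have h1 : (1 + ‖x‖) ^ k * ‖φ x‖ ≤ 2 ^ k * s := by
      have h2 := SchwartzMap.one_add_le_sup_seminorm_apply (𝕜 := ℂ) (m := (k, 0)) (k := k)
        (n := 0) le_rfl le_rfl φ x
      rw [norm_iteratedFDeriv_zero] at h2
      exact h2
    have h0 : (0 : ℝ) < (1 + ‖x‖) ^ k := by positivity
    rw [norm_mul, mul_assoc]
    gcongr
    rw [← div_eq_inv_mul, le_div_iff₀' h0]
    exact h1
  have hsum : Summable fun x => ‖μ.mass x * φ x‖ :=
    (hk.mul_right (2 ^ k * s)).of_nonneg_of_le (fun x => norm_nonneg _) hb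
  refine ⟨hsum, (norm_tsum_le_tsum_norm hsum).trans ?_⟩
  refine (hsum.tsum_le_tsum hb (hk.mul_right _)).trans (le_of_eq ?_)
  rw [tsum_mul_right]
  ring

/-- The tempered distribution `φ ↦ ∫ φ dμ = ∑ x, mass x * φ x` defined by a slowly increasing
pure point measure. -/
noncomputable def toTemperedDistribution {n : ℕ} (μ : PurePointMeasure n) :
    𝓢'(EuclideanSpace ℝ (Fin n), ℂ) :=
  ContinuousLinearMap.toPointwiseConvergenceCLM _ _ _ _ <|
    SchwartzMap.mkCLMtoNormedSpace (𝕜 := ℂ) (σ := RingHom.id ℂ)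
      (fun φ : 𝓢(EuclideanSpace ℝ (Fin n), ℂ) => ∑' x, μ.mass x * φ x)
      (fun φ ψ => by
        obtain ⟨_, _, _, h⟩ := μ.exists_bound
        simp only [add_apply, mul_add]
        exact (h φ).1.of_norm.tsum_add (h ψ).1.of_norm)
      (fun c φ => by
        simp only [smul_apply, smul_eq_mul, RingHom.id_apply, mul_left_comm _ c]
        exact tsum_mul_left)
      (by
        obtain ⟨k, C, hC, h⟩ := μ.exists_bound
        exact ⟨Finset.Iic (k, 0), C, hC, fun φ => (h φ).2⟩)

@[simp]
theorem toTemperedDistribution_apply {n : ℕ} (μ : PurePointMeasure n)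
    (φ : 𝓢(EuclideanSpace ℝ (Fin n), ℂ)) :
    μ.toTemperedDistribution φ = ∑' x, μ.mass x * φ x := rfl

end PurePointMeasure

/-- A tempered distribution is positive if it is non-negative on every Schwartz function `φ ≥ 0`.
(In the order on `ℂ`, `0 ≤ z` means that `z` is real and non-negative.) -/
def IsPositiveDistribution {n : ℕ} (α : 𝓢'(EuclideanSpace ℝ (Fin n), ℂ)) : Prop :=
  ∀ φ : 𝓢(EuclideanSpace ℝ (Fin n), ℂ), (∀ x, 0 ≤ φ x) → 0 ≤ α φ

/-- A tempered distribution is positive-definite if its Fourier transform is positive. -/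
def IsPositiveDefiniteDistribution {n : ℕ} (α : 𝓢'(EuclideanSpace ℝ (Fin n), ℂ)) : Prop :=
  IsPositiveDistribution (𝓕 α)

/-- A set is uniformly discrete if the infimum of the distances between its distinct points is
positive (the infimum being `∞` if there are no two distinct points). -/
def IsUniformlyDiscrete {n : ℕ} (A : Set (EuclideanSpace ℝ (Fin n))) : Prop :=
  0 < A.einfsep

/-- A set is relatively dense if, for some `R > 0`, it meets every ball of radius `R`. -/
def IsRelativelyDense {n : ℕ} (A : Set (EuclideanSpace ℝ (Fin n))) : Prop :=
  ∃ R : ℝ, 0 < R ∧ ∀ x, (Metric.ball x R ∩ A).Nonempty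

/-! Let `d = d(Λ)` and call `φ` band-limited if `𝓕 φ` vanishes outside the ball of radius `d`.
Against such `φ`, the measure `e(l·s) ν` with `l ∈ Λ` behaves like a constant multiple of Lebesgue
measure: its transform has a single atom that `𝓕 φ` sees (`tsum_mul_fourierChar_mul`). Smoothing `ν`
expands `s ↦ ν(s + h)` in characters with frequencies in `Λ`, so each correlation `∑ ν(s) ν(s + h)
δ_s` behaves in the same way (`exists_tendsto_correlation`). A positive measure of this kind, if not
zero, charges every ball of radius `R / d`: otherwise a band-limited function with positive
integral, `≤ 0` outside a ball, gives a contradiction (`exists_pos_forall_inter_nonempty`). So any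
difference `h` of two points of `S` recurs in every such ball. If `S` has arbitrarily short
differences, every slightly larger ball contains arbitrarily close pairs, hence infinitely many
points, and compactness gives accumulation points. -/

open MeasureTheory Filter Topology Metric
open scoped ContDiff

/-! ### Band-limited test functions. -/

section Schwartz

variable {V : Type*} [NormedAddCommGroup V] [InnerProductSpace ℝ V]

/-- The dilation `x ↦ f (d x)` of a Schwartz function. -/
noncomputable def SchwartzMap.dilate (f : 𝓢(V, ℂ)) (d : ℝ) (hd : d ≠ 0) : 𝓢(V, ℂ) :=
  f.compCLMOfContinuousLinearEquiv ℂ (ContinuousLinearEquiv.smulLeft (Units.mk0 d hd))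

@[simp]
theorem SchwartzMap.dilate_apply (f : 𝓢(V, ℂ)) {d : ℝ} (hd : d ≠ 0) (x : V) : f.dilate d hd x = f (d • x) := rfl

variable [FiniteDimensional ℝ V]

/-- A bump function centred at the origin, as a complex-valued Schwartz function. -/
noncomputable def ContDiffBump.toSchwartzMap (f : ContDiffBump (0 : V)) : 𝓢(V, ℂ) :=
  (f.hasCompactSupport.comp_left (g := ((↑) : ℝ → ℂ)) Complex.ofReal_zero).toSchwartzMap
    (Complex.ofRealCLM.contDiff.comp f.contDiff)

@[simp]
theorem ContDiffBump.toSchwartzMap_apply (f : ContDiffBump (0 : V)) (x : V) :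
    f.toSchwartzMap x = (f x : ℂ) := rfl

variable [MeasurableSpace V] [BorelSpace V]

namespace SchwartzMap

theorem fourier_compSubConstCLM_apply (f : 𝓢(V, ℂ)) (a w : V) :
    𝓕 (f.compSubConstCLM ℂ a) w = (Real.fourierChar (-inner ℝ a w) : ℂ) * 𝓕 f w := by
  have h := congrFun (VectorFourier.fourierIntegral_comp_add_right Real.fourierChar volume
    (innerₗ V) (⇑f) (-a)) w
  simp only [map_neg, LinearMap.neg_apply, innerₗ_apply_apply, Circle.smul_def, smul_eq_mul] at h
  have hf : ⇑(f.compSubConstCLM ℂ a) = ⇑f ∘ fun v => v + -a := by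
    ext v
    simp [sub_eq_add_neg]
  rw [fourier_coe, fourier_coe, hf]
  exact h

theorem fourierInv_compSubConstCLM_apply (f : 𝓢(V, ℂ)) (a w : V) :
    𝓕⁻ (f.compSubConstCLM ℂ a) w = (Real.fourierChar (inner ℝ a w) : ℂ) * 𝓕⁻ f w := by
  simp only [fourierInv_apply_eq, compCLMOfContinuousLinearEquiv_apply, Function.comp_apply]
  simp [fourier_compSubConstCLM_apply]

theorem fourier_fourier_apply (f : 𝓢(V, ℂ)) (x : V) : 𝓕 (𝓕 f) x = f (-x) := by
  have h : 𝓕⁻ (𝓕 f) (-x) = f (-x) := by simp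
  rw [← h, fourierInv_apply_eq]
  simp

theorem fourier_laplacian_apply (f : 𝓢(V, ℂ)) (x : V) :
    𝓕 (Laplacian.laplacian f) x = -(2 * Real.pi) ^ 2 * ‖x‖ ^ 2 * 𝓕 f x := by
  rw [laplacian_eq_fourierMultiplierCLM, FourierTransform.fourier_smul,
    fourierMultiplierCLM_apply, FourierTransform.fourier_fourierInv_eq, smul_apply,
    smulLeftCLM_apply_apply (by fun_prop)]
  simp [mul_assoc]

theorem fourier_zero_eq_integral (f : 𝓢(V, ℂ)) : 𝓕 f 0 = ∫ x, f x := by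
  simp [fourier_coe, Real.fourier_eq]

/-- There are a function `φ₀ ≥ 0` with `φ₀(0) > 0` and a function `φ₁` with `φ₁ ≤ 0` outside some
ball and positive integral, both with Fourier transform supported in the unit ball. -/
theorem exists_bandlimited_pair (V : Type*) [NormedAddCommGroup V] [InnerProductSpace ℝ V]
    [FiniteDimensional ℝ V] [MeasurableSpace V] [BorelSpace V] :
    ∃ (R : ℝ) (φ₀ φ₁ : 𝓢(V, ℂ)), 0 < R ∧ (∀ x, 0 ≤ φ₀ x) ∧ 0 < φ₀ 0 ∧
      (∀ x, R ≤ ‖x‖ → φ₁ x ≤ 0) ∧ 0 ≤ 𝓕 φ₀ 0 ∧ 0 < 𝓕 φ₁ 0 ∧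
      ∀ ξ, 1 ≤ ‖ξ‖ → 𝓕 φ₀ ξ = 0 ∧ 𝓕 φ₁ ξ = 0 := by
  -- Take `φ₀ = 𝓕 G` with `G = η * η`, so `φ₀ = (𝓕 η)² ≥ 0` because `η` is real and even, and `φ₁ =
  -- (R² - ‖x‖²) φ₀`. Radius `1/3` for `η` puts the support of `G` within `2/3 < 1`.
  let b : ContDiffBump (0 : V) := ⟨1 / 4, 1 / 3, by norm_num, by norm_num⟩
  let η := b.toSchwartzMap
  let B := ContinuousLinearMap.mul ℂ ℂ
  let G : 𝓢(V, ℂ) := SchwartzMap.convolution B η η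
  have hG : ∀ x, G x = ∫ t, η t * η (x - t) := fun x => by
    simp only [G, SchwartzMap.convolution_apply]
    rfl
  have hη : ∀ x : V, 1 / 3 ≤ ‖x‖ → η x = 0 := fun x hx => by
    simp only [η, ContDiffBump.toSchwartzMap_apply]
    rw [b.zero_of_le_dist (by simpa [b] using hx), Complex.ofReal_zero]
  have hGsupp : ∀ x : V, 2 / 3 < ‖x‖ → G x = 0 := fun x hx => by
    rw [hG]
    refine integral_eq_zero_of_ae (.of_forall fun t => ?_)
    rcases le_or_gt (1 / 3) ‖t‖ with h | h
    · simp [hη t h]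
    · have := norm_sub_norm_le x t
      simp [hη (x - t) (by linarith)]
  have hG0 : 0 < (G 0).re := by
    have h1 : G 0 = ((∫ t, b t * b t : ℝ) : ℂ) := by
      rw [hG, ← integral_complex_ofReal]
      refine integral_congr_ae (.of_forall fun t => ?_)
      simp [η, b.neg]
    rw [h1, Complex.ofReal_re]
    refine (b.continuous.mul b.continuous).integral_pos_of_hasCompactSupport_nonneg_nonzero
      (b.hasCompactSupport.mul_left) (fun t => mul_nonneg b.nonneg b.nonneg) (x := 0) ?_
    simp [b.one_of_mem_closedBall (mem_closedBall_self b.rIn_pos.le)]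
  have hreal : ∀ x, ∃ r : ℝ, 𝓕 η x = r := fun x => by
    refine ⟨(𝓕 η x).re, (Complex.conj_eq_iff_re.mp ?_).symm⟩
    rw [SchwartzMap.fourier_coe, Real.fourier_eq, ← integral_conj,
      ← integral_neg_eq_self]
    refine integral_congr_ae (.of_forall fun t => ?_)
    simp [η, Circle.smul_def, b.neg, ← Circle.coe_inv_eq_conj, ← AddChar.map_neg_eq_inv]
  have hFG : ∀ x, ∃ r : ℝ, 0 ≤ r ∧ 𝓕 G x = r := fun x => by
    obtain ⟨r, hr⟩ := hreal x
    refine ⟨r * r, mul_self_nonneg r, ?_⟩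
    simp [G, SchwartzMap.fourier_convolution, SchwartzMap.pairing_apply_apply, B, hr]
  have hFη0 : 0 < (𝓕 η 0).re := by
    have h1 : 𝓕 η 0 = ((∫ t, b t : ℝ) : ℂ) := by
      rw [SchwartzMap.fourier_zero_eq_integral, ← integral_complex_ofReal]
      rfl
    rw [h1, Complex.ofReal_re]
    exact b.integral_pos
  have hFG0 : 0 < 𝓕 G 0 := by
    obtain ⟨r, hr⟩ := hreal 0
    have : 𝓕 G 0 = ((r * r : ℝ) : ℂ) := by
      simp [G, SchwartzMap.fourier_convolution, SchwartzMap.pairing_apply_apply, B, hr]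
    rw [this, Complex.zero_lt_real]
    rw [hr, Complex.ofReal_re] at hFη0
    positivity
  -- Multiplying `𝓕 G` by `-‖x‖²` amounts to applying a scaled Laplacian to `G`, which does not
  -- enlarge the support.
  let c : ℂ := ((2 * Real.pi) ^ 2 : ℂ)⁻¹
  let L : 𝓢(V, ℂ) := c • Laplacian.laplacian G
  have hL : ∀ x, 𝓕 L x = -(‖x‖ : ℂ) ^ 2 * 𝓕 G x := fun x => by
    have hpi : (Real.pi : ℂ) ≠ 0 := by exact_mod_cast Real.pi_ne_zero
    simp only [L, FourierTransform.fourier_smul, smul_apply, smul_eq_mul, c,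
      SchwartzMap.fourier_laplacian_apply]
    field_simp
  have hLsupp : ∀ x : V, 2 / 3 < ‖x‖ → L x = 0 := fun x hx => by
    have h1 : (G : V → ℂ) =ᶠ[𝓝 x] fun _ => 0 := by
      filter_upwards [(isOpen_lt continuous_const continuous_norm).mem_nhds hx] with y hy
      exact hGsupp y hy
    simp only [L, smul_apply, SchwartzMap.laplacian_apply]
    rw [(InnerProductSpace.laplacian_congr_nhds h1).eq_of_nhds]
    simp
  -- The expression is `W 0`, which equals the integral of `φ₁`; since `G 0 > 0`, a large `R` makes
  -- it positive.
  obtain ⟨R, hR0, hR⟩ : ∃ R : ℝ, 0 < R ∧ 0 < R ^ 2 * (G 0).re + (L 0).re := by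
    have h : Tendsto (fun R : ℝ => R ^ 2 * (G 0).re + (L 0).re) atTop atTop :=
      tendsto_atTop_add_const_right _ _ ((tendsto_pow_atTop two_ne_zero).atTop_mul_const hG0)
    obtain ⟨R, h1, h2⟩ := ((eventually_gt_atTop 0).and (h.eventually_gt_atTop 0)).exists
    exact ⟨R, h1, h2⟩
  let W : 𝓢(V, ℂ) := ((R ^ 2 : ℝ) : ℂ) • G + L
  have hFW : ∀ x, 𝓕 W x = ((R ^ 2 - ‖x‖ ^ 2 : ℝ) : ℂ) * 𝓕 G x := fun x => by
    simp only [W, FourierTransform.fourier_add, FourierTransform.fourier_smul,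
      add_apply, smul_apply, smul_eq_mul, hL]
    push_cast
    ring
  refine ⟨R, 𝓕 G, 𝓕 W, hR0, fun x => ?_, hFG0, fun x hx => ?_, ?_, ?_, fun ξ hξ => ?_⟩
  · obtain ⟨r, hr0, hr⟩ := hFG x
    rw [hr]
    exact_mod_cast hr0
  · obtain ⟨r, hr0, hr⟩ := hFG x
    rw [hFW, hr, ← Complex.ofReal_mul]
    have : (R ^ 2 - ‖x‖ ^ 2) * r ≤ 0 :=
      mul_nonpos_of_nonpos_of_nonneg (by nlinarith) hr0
    exact_mod_cast this
  · rw [SchwartzMap.fourier_zero_eq_integral]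
    refine integral_nonneg fun x => ?_
    obtain ⟨r, hr0, hr⟩ := hFG x
    rw [Pi.zero_apply, hr]
    exact Complex.zero_le_real.mpr hr0
  · have him : 𝓕 (𝓕 W) 0 = ((∫ x, (𝓕 W x).re : ℝ) : ℂ) := by
      rw [SchwartzMap.fourier_zero_eq_integral, ← integral_complex_ofReal]
      refine integral_congr_ae (.of_forall fun x => ?_)
      obtain ⟨r, hr0, hr⟩ := hFG x
      simp only [hFW, hr, ← Complex.ofReal_mul, Complex.ofReal_re]
    have hre : (𝓕 (𝓕 W) 0).re = R ^ 2 * (G 0).re + (L 0).re := by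
      rw [SchwartzMap.fourier_fourier_apply, neg_zero]
      simp [W, -Complex.ofReal_pow]
    rw [him, Complex.ofReal_re] at hre
    rw [him, hre]
    exact_mod_cast hR
  · have h : 2 / 3 < ‖-ξ‖ := by rw [norm_neg]; linarith
    simp [SchwartzMap.fourier_fourier_apply, W, hGsupp _ h, hLsupp _ h]

theorem fourier_dilate_apply (f : 𝓢(V, ℂ)) {d : ℝ} (hd : 0 < d) (ξ : V) :
    𝓕 (f.dilate d hd.ne') ξ = ((d ^ Module.finrank ℝ V)⁻¹ : ℝ) * 𝓕 f (d⁻¹ • ξ) := by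
  simp only [fourier_coe, Real.fourier_eq]
  have h := Measure.integral_comp_smul volume
    (fun x : V => Real.fourierChar (-inner ℝ x (d⁻¹ • ξ)) • f x) d
  rw [abs_of_pos (by positivity)] at h
  rw [← Complex.real_smul, ← h]
  refine integral_congr_ae (.of_forall fun x => ?_)
  simp only [dilate_apply, inner_smul_left, inner_smul_right, RCLike.conj_to_real]
  rw [inv_mul_cancel_left₀ hd.ne']

end SchwartzMap
end Schwartz

/-! ### Bump functions that isolate single atoms. -/

section Bumps

variable (V : Type*) [NormedAddCommGroup V] [InnerProductSpace ℝ V] [FiniteDimensional ℝ V]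

/-- Bump functions at the origin whose supports shrink to a point. -/
noncomputable def shrinkingBump (k : ℕ) : ContDiffBump (0 : V) where
  rIn := 1 / (k + 1) / 2
  rOut := 1 / (k + 1)
  rIn_pos := by positivity
  rIn_lt_rOut := half_lt_self (by positivity)

/-- A bump function at the origin that dominates all the functions `shrinkingBump V k`. -/
noncomputable def dominatingBump : ContDiffBump (0 : V) := ⟨1, 2, one_pos, one_lt_two⟩

variable {V}

@[simp]
theorem shrinkingBump_zero (k : ℕ) : shrinkingBump V k 0 = 1 :=
  ContDiffBump.one_of_mem_closedBall _ (mem_closedBall_self (shrinkingBump V k).rIn_pos.le)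

theorem shrinkingBump_le (k : ℕ) (x : V) : shrinkingBump V k x ≤ dominatingBump V x := by
  rcases le_or_gt ‖x‖ 1 with h | h
  · rw [ContDiffBump.one_of_mem_closedBall (dominatingBump V) (by simpa [dominatingBump] using h)]
    exact ContDiffBump.le_one _
  · rw [ContDiffBump.zero_of_le_dist]
    · exact ContDiffBump.nonneg _
    · have h1 : (1 : ℝ) / (k + 1) ≤ 1 := by
        rw [div_le_one (by positivity)]
        linarith [k.cast_nonneg (α := ℝ)]
      simpa [shrinkingBump] using h1.trans h.le

theorem eventually_shrinkingBump_eq_zero {x : V} (hx : x ≠ 0) :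
    ∀ᶠ k in atTop, shrinkingBump V k x = 0 := by
  filter_upwards [tendsto_one_div_add_atTop_nhds_zero_nat.eventually
    (gt_mem_nhds (norm_pos_iff.mpr hx))] with k hk
  refine ContDiffBump.zero_of_le_dist _ ?_
  simpa [shrinkingBump] using hk.le

theorem norm_shrinkingBump_le (k : ℕ) (x : V) :
    ‖(shrinkingBump V k).toSchwartzMap x‖ ≤ ‖(dominatingBump V).toSchwartzMap x‖ := by
  simp only [ContDiffBump.toSchwartzMap_apply, Complex.norm_real, Real.norm_eq_abs,
    abs_of_nonneg (ContDiffBump.nonneg _)]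
  exact shrinkingBump_le k x

/-- The Fourier transforms of the shrinking bump functions tend to zero pointwise. -/
theorem tendsto_fourier_shrinkingBump [MeasurableSpace V] [BorelSpace V] [Nontrivial V] (w : V) :
    Tendsto (fun k => 𝓕 (shrinkingBump V k).toSchwartzMap w) atTop (𝓝 0) := by
  have h : Tendsto (fun k => ∫ v : V, ‖(shrinkingBump V k).toSchwartzMap v‖) atTop
      (𝓝 (∫ _ : V, (0 : ℝ))) := by
    refine tendsto_integral_of_dominated_convergence
      (fun v => ‖(dominatingBump V).toSchwartzMap v‖)
      (fun k => (SchwartzMap.continuous _).norm.aestronglyMeasurable)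
      (SchwartzMap.integrable _).norm (fun k => .of_forall fun v => ?_) ?_
    · rw [norm_norm]
      exact norm_shrinkingBump_le k v
    -- The bumps stay equal to `1` at the origin, which is a null set only in positive dimension.
    · filter_upwards [compl_mem_ae_iff.mpr (measure_singleton (0 : V))] with v hv
      refine tendsto_const_nhds.congr' ?_
      filter_upwards [eventually_shrinkingBump_eq_zero hv] with k hk
      simp [hk]
  rw [integral_zero] at h
  refine squeeze_zero_norm (fun k => ?_) h
  exact VectorFourier.norm_fourierIntegral_le_integral_norm _ _ _ _ _

end Bumps

/-! ### Pure point measures and their transforms. -/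

namespace PurePointMeasure

variable {n : ℕ} {μ ν : PurePointMeasure n}

theorem summable_mul (μ : PurePointMeasure n) (φ : 𝓢(EuclideanSpace ℝ (Fin n), ℂ)) :
    Summable fun x => μ.mass x * φ x := by
  obtain ⟨_, _, _, h⟩ := μ.exists_bound
  exact (h φ).1.of_norm

/-- The sums over shrinking neighbourhoods of a point tend to the mass of the point. -/
theorem tendsto_tsum_shrinkingBump (μ : PurePointMeasure n) (x : EuclideanSpace ℝ (Fin n)) :
    Tendsto (fun k => ∑' s, μ.mass s * (shrinkingBump _ k).toSchwartzMap (s - x)) atTop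
      (𝓝 (μ.mass x)) := by
  have hsum : ∑' s, (if s = x then μ.mass x else 0) = μ.mass x := by simp
  rw [← hsum]
  refine tendsto_tsum_of_dominated_convergence
    (μ.summable_mul ((dominatingBump _).toSchwartzMap.compSubConstCLM ℂ x)).norm
    (fun s => ?_) (.of_forall fun k s => ?_)
  · by_cases hs : s = x
    · simp [hs]
    · refine tendsto_const_nhds.congr' ?_
      filter_upwards [eventually_shrinkingBump_eq_zero (sub_ne_zero.mpr hs)] with k hk
      simp [hk, hs]
  · rw [norm_mul, norm_mul]
    exact mul_le_mul_of_nonneg_left (norm_shrinkingBump_le k _) (norm_nonneg _)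

theorem mass_nonneg_of_isPositive (h : IsPositiveDistribution ν.toTemperedDistribution)
    (x : EuclideanSpace ℝ (Fin n)) : 0 ≤ ν.mass x := by
  refine ge_of_tendsto' (ν.tendsto_tsum_shrinkingBump x) fun k => ?_
  have := h ((shrinkingBump _ k).toSchwartzMap.compSubConstCLM ℂ x) fun s => by
    simpa using ContDiffBump.nonneg _
  simpa using this

theorem tsum_eq_tsum_fourier
    (hF : 𝓕 μ.toTemperedDistribution = ν.toTemperedDistribution)
    (φ : 𝓢(EuclideanSpace ℝ (Fin n), ℂ)) :
    ∑' s, ν.mass s * φ s = ∑' l, μ.mass l * 𝓕 φ l := by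
  rw [← toTemperedDistribution_apply, ← hF, TemperedDistribution.fourier_apply,
    toTemperedDistribution_apply]

/-- A measure with at most one atom, in positive dimension, has no atoms in its spectrum. -/
theorem mass_eq_zero_of_subsingleton
    (hF : 𝓕 μ.toTemperedDistribution = ν.toTemperedDistribution)
    (hμ : μ.support.Subsingleton) [Nontrivial (EuclideanSpace ℝ (Fin n))]
    (x : EuclideanSpace ℝ (Fin n)) : ν.mass x = 0 := by
  have hp : ∃ p, ∀ l, l ≠ p → μ.mass l = 0 := by
    rcases μ.support.eq_empty_or_nonempty with h | ⟨p, hp⟩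
    · exact ⟨0, fun l _ => by_contra fun hl => (h ▸ (show l ∈ μ.support from hl) : l ∈ (∅ : Set _))⟩
    · exact ⟨p, fun l hl => by_contra fun hl' => hl (hμ hl' hp)⟩
  obtain ⟨p, hp⟩ := hp
  refine tendsto_nhds_unique (ν.tendsto_tsum_shrinkingBump x) ?_
  refine squeeze_zero_norm (a := fun k =>
    ‖μ.mass p‖ * ‖𝓕 (shrinkingBump (EuclideanSpace ℝ (Fin n)) k).toSchwartzMap p‖) (fun k => ?_) ?_
  · have h1 := tsum_eq_tsum_fourier hF
      ((shrinkingBump _ k).toSchwartzMap.compSubConstCLM ℂ x)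
    simp only [SchwartzMap.compSubConstCLM_apply] at h1
    rw [h1, tsum_eq_single p fun l hl => by rw [hp l hl, zero_mul],
      SchwartzMap.fourier_compSubConstCLM_apply, norm_mul, norm_mul, Circle.norm_coe, one_mul]
  · simpa using ((tendsto_fourier_shrinkingBump p).norm.const_mul ‖μ.mass p‖)

/-- For a test function band-limited to the separation of the support of `μ`, a twist by a
frequency in the support picks out one atom of `μ`. -/
theorem tsum_mul_fourierChar_mul
    (hF : 𝓕 μ.toTemperedDistribution = ν.toTemperedDistribution) {d : ℝ}
    (hd : ∀ l ∈ μ.support, ∀ l' ∈ μ.support, l ≠ l' → d ≤ dist l l')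
    {φ : 𝓢(EuclideanSpace ℝ (Fin n), ℂ)} (hφ : ∀ ξ, d ≤ ‖ξ‖ → 𝓕 φ ξ = 0)
    {l : EuclideanSpace ℝ (Fin n)} (hl : l ∈ μ.support) (x : EuclideanSpace ℝ (Fin n)) :
    ∑' s, ν.mass s * φ (s - x) * (Real.fourierChar (inner ℝ l s) : ℂ) = μ.mass l * 𝓕 φ 0 := by
  -- The test function is `e(l·s) φ(s - x)`; its transform vanishes at distance `≥ d` from `l`,
  -- hence at every other atom of `μ`.
  have h := tsum_eq_tsum_fourier hF
    (𝓕⁻ ((𝓕 (φ.compSubConstCLM ℂ x)).compSubConstCLM ℂ l))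
  rw [FourierTransform.fourier_fourierInv_eq] at h
  refine Eq.trans (tsum_congr fun s => ?_) (h.trans ((tsum_eq_single l ?_).trans ?_))
  · rw [SchwartzMap.fourierInv_compSubConstCLM_apply, FourierTransform.fourierInv_fourier_eq,
      SchwartzMap.compSubConstCLM_apply]
    ring
  · intro l' hl'
    by_cases hm : l' ∈ μ.support
    · have := hd l' hm l hl hl'
      rw [SchwartzMap.compSubConstCLM_apply, SchwartzMap.fourier_compSubConstCLM_apply,
        hφ _ (by rwa [← dist_eq_norm]), mul_zero, mul_zero]
    · rw [show μ.mass l' = 0 from not_not.mp hm, zero_mul]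
  · rw [SchwartzMap.compSubConstCLM_apply, sub_self, SchwartzMap.fourier_compSubConstCLM_apply,
      inner_zero_right, neg_zero, AddChar.map_zero_eq_one, Circle.coe_one, one_mul]

/-- Positivity of `ν` makes the sum against the dominating bump equal to its sum of absolute values;
on the Fourier side, translation by `x` only changes phases. The uniformity in `k` and `x` is what
dominated convergence needs for the correlations. -/
theorem exists_norm_tsum_shrinkingBump_le
    (hF : 𝓕 μ.toTemperedDistribution = ν.toTemperedDistribution) (hν : ∀ s, 0 ≤ ν.mass s) :
    ∃ M, ∀ (k : ℕ) (x : EuclideanSpace ℝ (Fin n)),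
      ‖∑' s, ν.mass s * (shrinkingBump _ k).toSchwartzMap (s - x)‖ ≤ M := by
  let X := (dominatingBump (EuclideanSpace ℝ (Fin n))).toSchwartzMap
  refine ⟨∑' l, ‖μ.mass l * 𝓕 X l‖, fun k x => ?_⟩
  have hX : Summable fun s => ‖ν.mass s * X (s - x)‖ :=
    (ν.summable_mul (X.compSubConstCLM ℂ x)).norm
  have hle : ∀ s, ‖ν.mass s * (shrinkingBump _ k).toSchwartzMap (s - x)‖ ≤
      ‖ν.mass s * X (s - x)‖ := fun s => by
    rw [norm_mul, norm_mul]
    exact mul_le_mul_of_nonneg_left (norm_shrinkingBump_le k _) (norm_nonneg _)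
  have hsum := hX.of_nonneg_of_le (fun _ => norm_nonneg _) hle
  have hnorm : ((∑' s, ‖ν.mass s * X (s - x)‖ : ℝ) : ℂ) = ∑' s, ν.mass s * X (s - x) := by
    rw [Complex.ofReal_tsum]
    refine tsum_congr fun s => (Complex.eq_coe_norm_of_nonneg (mul_nonneg (hν s) ?_)).symm
    exact Complex.zero_le_real.mpr (ContDiffBump.nonneg _)
  have hX' : ∑' s, ν.mass s * X (s - x) = ∑' l, μ.mass l * 𝓕 (X.compSubConstCLM ℂ x) l :=
    tsum_eq_tsum_fourier hF (X.compSubConstCLM ℂ x)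
  have hphase : ∀ l, ‖μ.mass l * 𝓕 (X.compSubConstCLM ℂ x) l‖ = ‖μ.mass l * 𝓕 X l‖ := fun l => by
    rw [SchwartzMap.fourier_compSubConstCLM_apply, norm_mul, norm_mul, norm_mul, Circle.norm_coe,
      one_mul]
  calc _ ≤ ∑' s, ‖ν.mass s * (shrinkingBump _ k).toSchwartzMap (s - x)‖ :=
        norm_tsum_le_tsum_norm hsum
    _ ≤ ∑' s, ‖ν.mass s * X (s - x)‖ := hsum.tsum_le_tsum hle hX
    _ = ‖((∑' s, ‖ν.mass s * X (s - x)‖ : ℝ) : ℂ)‖ := by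
        rw [Complex.norm_real, Real.norm_of_nonneg (tsum_nonneg fun _ => norm_nonneg _)]
    _ = ‖∑' l, μ.mass l * 𝓕 (X.compSubConstCLM ℂ x) l‖ := by rw [hnorm, hX']
    _ ≤ ∑' l, ‖μ.mass l * 𝓕 (X.compSubConstCLM ℂ x) l‖ :=
        norm_tsum_le_tsum_norm (μ.summable_mul _).norm
    _ = _ := tsum_congr hphase

/-- The sums of a positive measure over small neighbourhoods, in terms of its inverse Fourier
transform. -/
theorem tsum_shrinkingBump_eq
    (hF : 𝓕 μ.toTemperedDistribution = ν.toTemperedDistribution) (hν : ∀ s, 0 ≤ ν.mass s)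
    (k : ℕ) (s h : EuclideanSpace ℝ (Fin n)) :
    ∑' t, ν.mass t * (shrinkingBump _ k).toSchwartzMap (t - (s + h)) =
      ∑' l, (starRingEnd ℂ) (μ.mass l * 𝓕 (shrinkingBump (EuclideanSpace ℝ (Fin n)) k).toSchwartzMap l) *
        Real.fourierChar (inner ℝ l h) * Real.fourierChar (inner ℝ l s) := by
  -- Conjugation fixes the left side, as `ν ≥ 0`, and turns the phases `e(-l·s)` into the twists
  -- `e(l·s)` with `l ∈ Λ`.
  have h1 := congrArg (starRingEnd ℂ) (tsum_eq_tsum_fourier hF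
    ((shrinkingBump _ k).toSchwartzMap.compSubConstCLM ℂ (s + h)))
  rw [Complex.conj_tsum, Complex.conj_tsum] at h1
  refine Eq.trans (tsum_congr fun t => ?_) (h1.trans (tsum_congr fun l => ?_))
  · rw [SchwartzMap.compSubConstCLM_apply, ContDiffBump.toSchwartzMap_apply, map_mul,
      Complex.conj_ofReal, Complex.conj_eq_iff_im.mpr (Complex.nonneg_iff.mp (hν t)).2.symm]
  · rw [SchwartzMap.fourier_compSubConstCLM_apply, map_mul, map_mul, map_mul,
      ← Circle.coe_inv_eq_conj, ← AddChar.map_neg_eq_inv, neg_neg, real_inner_comm,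
      inner_add_right, AddChar.map_add_eq_mul, Circle.coe_mul]
    ring

/-! ### Correlations of the spectrum. -/

/-- If `μ` has separated support and non-negative Fourier transform `ν`, then all the correlation
measures `∑ s, ν {s} ν {s + h} δ_s` have constant convolutions with test functions that are
band-limited to the separation. -/
theorem exists_tendsto_correlation
    (hF : 𝓕 μ.toTemperedDistribution = ν.toTemperedDistribution) (hν : ∀ s, 0 ≤ ν.mass s) {d : ℝ}
    (hd : ∀ l ∈ μ.support, ∀ l' ∈ μ.support, l ≠ l' → d ≤ dist l l')
    (h : EuclideanSpace ℝ (Fin n)) :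
    ∃ D : ℕ → ℂ, ∀ φ : 𝓢(EuclideanSpace ℝ (Fin n), ℂ), (∀ ξ, d ≤ ‖ξ‖ → 𝓕 φ ξ = 0) →
      ∀ x, Summable (fun s => ν.mass s * φ (s - x) * ν.mass (s + h)) ∧
        Tendsto (fun k => D k * 𝓕 φ 0) atTop
          (𝓝 (∑' s, ν.mass s * φ (s - x) * ν.mass (s + h))) := by
  obtain ⟨M, hM⟩ := exists_norm_tsum_shrinkingBump_le hF hν
  let c : ℕ → EuclideanSpace ℝ (Fin n) → ℂ := fun k l =>
    (starRingEnd ℂ) (μ.mass l * 𝓕 (shrinkingBump (EuclideanSpace ℝ (Fin n)) k).toSchwartzMap l) *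
      Real.fourierChar (inner ℝ l h)
  have hc : ∀ k, Summable fun l => ‖c k l‖ := fun k =>
    (μ.summable_mul (𝓕 (shrinkingBump (EuclideanSpace ℝ (Fin n)) k).toSchwartzMap)).norm.congr fun l => by
      simp only [c]
      rw [norm_mul ((starRingEnd ℂ) _), Circle.norm_coe, mul_one, RCLike.norm_conj]
  -- These constants depend on neither `φ` nor `x`: they come from replacing `ν(s + h)` by its
  -- smoothing, a character series with coefficients `c k l`, and interchanging the two sums.
  refine ⟨fun k => ∑' l, c k l * μ.mass l, fun φ hφ x => ?_⟩
  have hs : Summable fun s => ‖ν.mass s * φ (s - x)‖ :=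
    (ν.summable_mul (φ.compSubConstCLM ℂ x)).norm
  have hdom : ∀ k s, ‖ν.mass s * φ (s - x) *
      ∑' t, ν.mass t * (shrinkingBump _ k).toSchwartzMap (t - (s + h))‖ ≤
      ‖ν.mass s * φ (s - x)‖ * M := fun k s => by
    rw [norm_mul]
    exact mul_le_mul_of_nonneg_left (hM k _) (norm_nonneg _)
  have hlim : ∀ s, Tendsto (fun k : ℕ => ν.mass s * φ (s - x) *
      ∑' t, ν.mass t * (shrinkingBump _ k).toSchwartzMap (t - (s + h))) atTop
      (𝓝 (ν.mass s * φ (s - x) * ν.mass (s + h))) := fun s =>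
    (ν.tendsto_tsum_shrinkingBump (s + h)).const_mul _
  refine ⟨.of_norm_bounded (hs.mul_right M) fun s =>
    le_of_tendsto' (hlim s).norm fun k => hdom k s, ?_⟩
  refine (tendsto_tsum_of_dominated_convergence (hs.mul_right M) hlim
    (.of_forall fun k s => hdom k s)).congr fun k => ?_
  have hsum : Summable (Function.uncurry fun s l : EuclideanSpace ℝ (Fin n) =>
      ν.mass s * φ (s - x) * (c k l * Real.fourierChar (inner ℝ l s))) := by
    refine Summable.of_norm ((hs.mul_of_nonneg (hc k) (fun _ => norm_nonneg _)
      (fun _ => norm_nonneg _)).congr fun p => ?_)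
    rw [Function.uncurry, norm_mul (ν.mass p.1 * φ (p.1 - x)) (c k p.2 * _), norm_mul (c k p.2) _,
      Circle.norm_coe, mul_one]
  calc _ = ∑' s, ∑' l, ν.mass s * φ (s - x) * (c k l * Real.fourierChar (inner ℝ l s)) := by
        refine tsum_congr fun s => ?_
        rw [tsum_shrinkingBump_eq hF hν, tsum_mul_left]
    _ = ∑' l, ∑' s, ν.mass s * φ (s - x) * (c k l * Real.fourierChar (inner ℝ l s)) :=
        hsum.tsum_comm.symm
    _ = ∑' l, c k l * μ.mass l * 𝓕 φ 0 := by
        refine tsum_congr fun l => ?_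
        by_cases hl : l ∈ μ.support
        · rw [mul_assoc, ← tsum_mul_fourierChar_mul hF hd hφ hl x, ← tsum_mul_left]
          exact tsum_congr fun s => by ring
        · simp [c, show μ.mass l = 0 from not_not.mp hl]
    _ = _ := tsum_mul_right

/-- The spectrum meets its translate by a difference of two of its points in every large ball. -/
theorem exists_pos_forall_inter_nonempty (n : ℕ) : ∃ R : ℝ, 0 < R ∧ ∀ μ ν : PurePointMeasure n,
    𝓕 μ.toTemperedDistribution = ν.toTemperedDistribution → (∀ s, 0 ≤ ν.mass s) →
    ∀ d : ℝ, 0 < d → (∀ l ∈ μ.support, ∀ l' ∈ μ.support, l ≠ l' → d ≤ dist l l') →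
    ∀ p h, p ∈ ν.support → p + h ∈ ν.support →
    ∀ x, ∃ s ∈ ball x (R / d), s ∈ ν.support ∧ s + h ∈ ν.support := by
  obtain ⟨R, φ₀, φ₁, hR, h0, h00, h1, hF0, hF1, hband⟩ :=
    SchwartzMap.exists_bandlimited_pair (EuclideanSpace ℝ (Fin n))
  refine ⟨R, hR, fun μ ν hF hν d hd0 hd p h hp hph x => ?_⟩
  by_contra! hcon
  obtain ⟨D, hD⟩ := exists_tendsto_correlation hF hν hd h
  let e : ℝ := (d ^ Module.finrank ℝ (EuclideanSpace ℝ (Fin n)))⁻¹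
  have he : 0 < (e : ℂ) := Complex.zero_lt_real.mpr (by positivity)
  have hn : ∀ ξ : EuclideanSpace ℝ (Fin n), d ≤ ‖ξ‖ → 1 ≤ ‖d⁻¹ • ξ‖ := fun ξ hξ => by
    rw [norm_smul, norm_inv, Real.norm_of_nonneg hd0.le, ← div_eq_inv_mul, one_le_div hd0]
    exact hξ
  -- Dilating by `d` moves the band limit from `1` to `d` and the radius from `R` to `R / d`.
  -- Centring `φ₀` at `p` makes the term at `p` positive; centring `φ₁` at `x` tests the ball
  -- assumed to be missed.
  obtain ⟨hs0, ht0⟩ := hD (φ₀.dilate d hd0.ne')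
    (fun ξ hξ => by rw [SchwartzMap.fourier_dilate_apply _ hd0, (hband _ (hn ξ hξ)).1, mul_zero]) p
  obtain ⟨-, ht1⟩ := hD (φ₁.dilate d hd0.ne')
    (fun ξ hξ => by rw [SchwartzMap.fourier_dilate_apply _ hd0, (hband _ (hn ξ hξ)).2, mul_zero]) x
  have hpos : 0 < ∑' s, ν.mass s * φ₀.dilate d hd0.ne' (s - p) * ν.mass (s + h) := by
    refine hs0.tsum_pos (fun s => ?_) p ?_
    · exact mul_nonneg (mul_nonneg (hν s) (h0 _)) (hν _)
    · refine mul_pos (mul_pos ((hν p).lt_of_ne' hp) ?_) ((hν _).lt_of_ne' hph)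
      simpa using h00
  have hneg : ∑' s, ν.mass s * φ₁.dilate d hd0.ne' (s - x) * ν.mass (s + h) ≤ 0 := by
    refine tsum_nonpos fun s => ?_
    by_cases hs : s ∈ ball x (R / d)
    · by_cases hs1 : s ∈ ν.support
      · rw [show ν.mass (s + h) = 0 from not_not.mp (hcon s hs hs1), mul_zero]
      · rw [show ν.mass s = 0 from not_not.mp hs1, zero_mul, zero_mul]
    · refine mul_nonpos_of_nonpos_of_nonneg
        (mul_nonpos_of_nonneg_of_nonpos (hν s) (h1 _ ?_)) (hν _)
      rw [mem_ball, not_lt, dist_eq_norm, div_le_iff₀' hd0] at hs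
      change R ≤ ‖d • (s - x)‖
      rwa [norm_smul, Real.norm_of_nonneg hd0.le]
  simp only [SchwartzMap.fourier_dilate_apply _ hd0, smul_zero] at ht0 ht1
  -- Cross-multiplying the two limits eliminates `D k`, so its own convergence is never needed; the
  -- two sides then have incompatible signs.
  have key := tendsto_nhds_unique (ht0.mul_const (e * 𝓕 φ₁ 0))
    ((ht1.mul_const (e * 𝓕 φ₀ 0)).congr fun k => by ring)
  exact absurd (key ▸ mul_pos hpos (mul_pos he hF1))
    (mul_nonpos_of_nonpos_of_nonneg hneg (mul_nonneg he.le hF0)).not_gt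

end PurePointMeasure

/-! ### The main theorem. -/

open PurePointMeasure in
theorem mainTheorem2 (n : ℕ) :
    ∃ C : ℝ, 0 < C ∧ ∀ μ ν : PurePointMeasure n,
      IsPositiveDefiniteDistribution μ.toTemperedDistribution →
      𝓕 μ.toTemperedDistribution = ν.toTemperedDistribution →
      IsUniformlyDiscrete μ.support →
      (IsUniformlyDiscrete ν.support ∨ IsRelativelyDense (derivedSet ν.support)) ∧
      (¬ IsUniformlyDiscrete ν.support →
        ∀ x : EuclideanSpace ℝ (Fin n),
          (Metric.ball x (C / μ.support.infsep) ∩ ν.support).Infinite) := by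
  obtain ⟨R, hR, hmeet⟩ := exists_pos_forall_inter_nonempty n
  -- `R / d` locates one point of a close pair; the additional `1 / d` leaves room for the other.
  refine ⟨R + 1, by positivity, fun μ ν hpd hF hΛ => ?_⟩
  have hν : ∀ s, 0 ≤ ν.mass s := mass_nonneg_of_isPositive (hF ▸ hpd)
  have hinf : ¬ IsUniformlyDiscrete ν.support → 0 < μ.support.infsep ∧
      ∀ x : EuclideanSpace ℝ (Fin n),
        (ball x ((R + 1) / μ.support.infsep) ∩ ν.support).Infinite := by
    intro hS
    have hS0 := Set.einfsep_zero.mp (not_not.mp (pos_iff_ne_zero.not.mp hS))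
    -- For at most one atom `infsep` takes the value `0` rather than `∞`, and the ball would be
    -- empty. This case cannot occur, since then `ν` would have no atoms although `S` has two
    -- distinct points.
    have hnt : μ.support.Nontrivial := by
      rw [← Set.not_subsingleton_iff]
      intro hsub
      obtain ⟨a, ha, b, -, hab, -⟩ := hS0 1 one_pos
      have : Nontrivial (EuclideanSpace ℝ (Fin n)) := ⟨a, b, hab⟩
      exact ha (mass_eq_zero_of_subsingleton hF hsub a)
    have hd : 0 < μ.support.infsep := Set.infsep_pos.mpr ⟨hΛ, hnt.einfsep_lt_top⟩
    refine ⟨hd, fun x hfin => ?_⟩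
    -- Finitely many points would have a positive separation `ε`; a pair of `S` closer than `ε`,
    -- translated into the ball, contradicts this.
    obtain ⟨ε, hε, hsep⟩ := Set.einfsep_pos.mp hfin.einfsep_pos
    obtain ⟨a, ha, b, hb, hab, hlt⟩ := hS0 (min ε (ENNReal.ofReal (1 / μ.support.infsep)))
      (lt_min hε (ENNReal.ofReal_pos.mpr (by positivity)))
    obtain ⟨s, hs, hs1, hs2⟩ := hmeet μ ν hF hν _ hd
      (fun l hl l' hl' hne => Set.infsep_le_dist_of_mem hl hl' hne) a (b - a) ha (by simpa) x
    have hdist : dist s (s + (b - a)) = dist a b := by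
      rw [dist_self_add_right, dist_comm, dist_eq_norm]
    have hlt' : dist a b < 1 / μ.support.infsep := by
      have := hlt.trans_le (min_le_right _ _)
      rwa [edist_dist, ENNReal.ofReal_lt_ofReal_iff (by positivity)] at this
    rw [mem_ball] at hs
    have h1 : s ∈ ball x ((R + 1) / μ.support.infsep) := by
      rw [mem_ball, add_div]
      exact hs.trans (lt_add_of_pos_right _ (by positivity))
    have h2 : s + (b - a) ∈ ball x ((R + 1) / μ.support.infsep) := by
      rw [mem_ball, add_div]
      have := dist_triangle_left (s + (b - a)) x s
      linarith
    have h3 := hsep s ⟨h1, hs1⟩ _ ⟨h2, hs2⟩ (by simpa [eq_comm, sub_eq_zero] using hab)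
    rw [edist_dist, hdist, ← edist_dist] at h3
    exact absurd (hlt.trans_le (min_le_left _ _)) h3.not_gt
  refine ⟨or_iff_not_imp_left.mpr fun hS => ?_, fun hS => (hinf hS).2⟩
  obtain ⟨hd, h⟩ := hinf hS
  refine ⟨(R + 1) / μ.support.infsep + 1, by positivity, fun x => ?_⟩
  obtain ⟨y, hy, hacc⟩ := (h x).exists_accPt_of_subset_isCompact
    (isCompact_closedBall x ((R + 1) / μ.support.infsep))
    (Set.inter_subset_left.trans ball_subset_closedBall)
  exact ⟨y, closedBall_subset_ball (lt_add_one _) hy,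
    hacc.mono (principal_mono.mpr Set.inter_subset_right)⟩
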